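/- Let $\mathbb B=\{0,1\}$, $\mathbb S=\mathbb B^*$ (finite binary strings, with empty string $\epsilon$), $\mathbb O=\mathbb B^{\mathbb S}$. Registers are $X_i,Y_i,S_i$ ($i\in\mathbb N$), $R,Q,Z,T$; a store $\Sigma$ assigns a string to every register. Expressions are $$e ::= \epsilon \mid e.0 \mid e.1 \mid r \mid e\sqsubseteq r \mid e\wedge r\mid \neg e \qquad (r \text{ a register}).$$ In a store $\Sigma$, $e.b$ has the value of $e$ followed by the bit $b$; $r$ has value $\Sigma(r)$; $e\sqsubseteq r$ has value $1$ if the value of $e$ is a prefix of $\Sigma(r)$, and $0$ otherwise; $e\wedge r$ has value $1$ if the value of $e$ and $\Sigma(r)$ are both the string $1$, and $0$ otherwise; $\neg e$ has value $1$ if $e$ has value $0$, and $0$ otherwise. $\mathrm{SIFP}_{\mathrm{RA}}$ programs are built from assignments $r\leftarrow e$ and instructions $\mathtt{Flip}(e)$ by sequencing $s;t$ and loops $\mathtt{while}(e)\{s\}$ (the body is executed as long as $e$ has value $1$). They are run with an oracle $\eta\in\mathbb O$, and $\mathtt{Flip}(e)$ puts the bit $\eta(\sigma)$ into $R$, where $\sigma$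 is the value of $e$. $\mathrm{SIFP}_{\mathrm{LA}}$ programs are built in the same way with the instruction $\mathtt{RandBit}()$ in place of $\mathtt{Flip}(e)$; they are run with a stream $\omega\in\mathbb B^{\mathbb N}$, and $\mathtt{RandBit}()$ removes the first bit of what is left of the stream and puts it into $R$. For $x=(x_1,\dots,x_n)\in\mathbb S^n$, $[\![P]\!](x,\eta)$ (resp. $[\![Q]\!](x,\omega)$) denotes the content of $R$ at the end of the run that starts with $x_i$ in $X_i$ for $1\le i\le n$ and $\epsilon$ in all other registers. A program with $n$ inputs is total if it halts for all $x\in\mathbb S^n$ and all $\eta$ (resp. $\omega$); it is poly-time if there is a polynomial $p$ such that for all $x$ and all $\eta$ (resp. $\omega$) it halts after executing at most $p(|x_1|+\dots+|x_n|)$ elementary instructions (assignments, $\mathtt{Flip}$, $\mathtt{RandBit}$, evaluations of loop guards). Let $\mu$ denote the measure on $\mathbb O$, and that on $\mathbb B^{\mathbb N}$, for which the bits are independent and uniform. **Lemma.** Let $n\in\mathbb N$. For each $\mathrm{SIFP}_{\mathrm{RA}}$ program $P$ that is total as a program with $n$ inputs there is an $\mathrm{SIFP}_{\mathrm{LA}}$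 program $Q$, also total as a program with $n$ inputs, such that for all $x\in\mathbb S^n$ and $y\in\mathbb S$ $$\mu(\{\eta\in\mathbb O \mid [\![P]\!](x,\eta)=y\})=\mu(\{\omega\in\mathbb B^{\mathbb N}\mid [\![Q]\!](x,\omega)=y\}).$$ Moreover, if $P$ is poly-time, then so is $Q$. -/

import Mathlib

open MeasureTheory

namespace SIFP

/-- Finite binary strings; `true` is the bit 1 and `false` the bit 0. -/
abbrev Str : Type := List Bool

/-- Register names. -/
inductive Id : Type
  | X (i : ℕ)
  | Y (i : ℕ)
  | S (i : ℕ)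
  | R
  | Q
  | Z
  | T
  deriving DecidableEq

/-- Expressions: the empty string, appending a bit, reading a register, prefix test against a
register, conjunction with a register, negation. -/
inductive Exp : Type
  | eps
  | snoc (e : Exp) (b : Bool)
  | reg (r : Id)
  | prefixOf (e : Exp) (r : Id)
  | and (e : Exp) (r : Id)
  | not (e : Exp)

/-- Stores. All stores reached from the empty store are total. -/
abbrev Store : Type := Id → Str

/-- The empty store: total and constantly the empty string. -/
def Store.empty : Store := fun _ => []

/-- The store `st[r ← σ]`. -/
def Store.set (st : Store) (r : Id) (σ : Str) : Store := Function.update st r σ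

/-- The initial store `[ ][X₁ ← x₁] ⋯ [Xₙ ← xₙ]`; the input `xᵢ` is `x (i - 1)`. -/
def Store.init {n : ℕ} (x : Fin n → Str) : Store :=
  (List.finRange n).foldl (fun st i => st.set (Id.X (i.val + 1)) (x i)) Store.empty

/-- The value of an expression in a store; truth values are the one-letter strings 1 and 0. -/
def Exp.eval (st : Store) : Exp → Str
  | .eps => []
  | .snoc e b => e.eval st ++ [b]
  | .reg r => st r
  | .prefixOf e r => if e.eval st <+: st r then [true] else [false]
  | .and e r => if e.eval st = [true] ∧ st r = [true] then [true] else [false]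
  | .not e => if e.eval st = [false] then [true] else [false]

/-- Programs with random access to the oracle. -/
inductive StmRA : Type
  | assign (r : Id) (e : Exp)
  | seq (s t : StmRA)
  | while (e : Exp) (s : StmRA)
  | flip (e : Exp)

/-- Programs with sequential access to the random bits. -/
inductive StmLA : Type
  | assign (r : Id) (e : Exp)
  | seq (s t : StmLA)
  | while (e : Exp) (s : StmLA)
  | randBit

/-- Big-step semantics of random-access programs, with a step counter: `RunRA η P st k st'` says
that `P`, started in the store `st` with oracle `η`, ends in the store `st'` after executing `k`
elementary instructions (assignments, `Flip`s and evaluations of loop guards). Expressions cannot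
concatenate two registers, so one step increases the maximal register length by at most a constant
depending on the program; hence charging for the lengths of the strings handled would lead to the
same notion of polynomial time. -/
inductive RunRA (η : Str → Bool) : StmRA → Store → ℕ → Store → Prop
  | assign (r : Id) (e : Exp) (st : Store) :
      RunRA η (.assign r e) st 1 (st.set r (e.eval st))
  | seq {s t : StmRA} {st st' st'' : Store} {k l : ℕ} :
      RunRA η s st k st' → RunRA η t st' l st'' → RunRA η (.seq s t) st (k + l) st''
  | while_true {e : Exp} {s : StmRA} {st st' st'' : Store} {k l : ℕ} :
      e.eval st = [true] → RunRA η s st k st' → RunRA η (.while e s) st' l st'' →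
      RunRA η (.while e s) st (1 + k + l) st''
  | while_false {e : Exp} {s : StmRA} {st : Store} :
      e.eval st ≠ [true] → RunRA η (.while e s) st 1 st
  | flip (e : Exp) (st : Store) :
      RunRA η (.flip e) st 1 (st.set .R [η (e.eval st)])

/-- Big-step semantics of sequential-access programs, with the same step counter:
`RunLA P st ω k st' ω'` says that `P`, started in the store `st` with the stream `ω` of random bits,
ends after `k` elementary instructions in the store `st'` with the unread part `ω'` of `ω`. -/
inductive RunLA : StmLA → Store → (ℕ → Bool) → ℕ → Store → (ℕ → Bool) → Prop
  | assign (r : Id) (e : Exp) (st : Store) (ω : ℕ → Bool) :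
      RunLA (.assign r e) st ω 1 (st.set r (e.eval st)) ω
  | seq {s t : StmLA} {st st' st'' : Store} {ω ω' ω'' : ℕ → Bool} {k l : ℕ} :
      RunLA s st ω k st' ω' → RunLA t st' ω' l st'' ω'' →
      RunLA (.seq s t) st ω (k + l) st'' ω''
  | while_true {e : Exp} {s : StmLA} {st st' st'' : Store} {ω ω' ω'' : ℕ → Bool} {k l : ℕ} :
      e.eval st = [true] → RunLA s st ω k st' ω' → RunLA (.while e s) st' ω' l st'' ω'' →
      RunLA (.while e s) st ω (1 + k + l) st'' ω''
  | while_false {e : Exp} {s : StmLA} {st : Store} {ω : ℕ → Bool} :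
      e.eval st ≠ [true] → RunLA (.while e s) st ω 1 st ω
  | randBit (st : Store) (ω : ℕ → Bool) :
      RunLA .randBit st ω 1 (st.set .R [ω 0]) (fun i => ω (i + 1))

/-- `⟦P⟧(x₁, …, xₙ, η) = y`, with value the final content of the register `R`; the run takes
`k` steps. -/
def StmRA.EvalIn {n : ℕ} (P : StmRA) (x : Fin n → Str) (η : Str → Bool) (k : ℕ) (y : Str) : Prop :=
  ∃ st : Store, RunRA η P (Store.init x) k st ∧ st .R = y

/-- `⟦P⟧(x₁, …, xₙ, η) = y`. -/
def StmRA.Eval {n : ℕ} (P : StmRA) (x : Fin n → Str) (η : Str → Bool) (y : Str) : Prop :=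
  ∃ k : ℕ, P.EvalIn x η k y

/-- `⟦Q⟧(x₁, …, xₙ, ω) = y`, with value the final content of the register `R`; the run takes
`k` steps. -/
def StmLA.EvalIn {n : ℕ} (Q : StmLA) (x : Fin n → Str) (ω : ℕ → Bool) (k : ℕ) (y : Str) : Prop :=
  ∃ (st : Store) (ω' : ℕ → Bool), RunLA Q (Store.init x) ω k st ω' ∧ st .R = y

/-- `⟦Q⟧(x₁, …, xₙ, ω) = y`. -/
def StmLA.Eval {n : ℕ} (Q : StmLA) (x : Fin n → Str) (ω : ℕ → Bool) (y : Str) : Prop :=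
  ∃ k : ℕ, Q.EvalIn x ω k y

/-- `P` is total as a program with `n` inputs: it halts on all inputs and all oracles. -/
def StmRA.Total (n : ℕ) (P : StmRA) : Prop :=
  ∀ (x : Fin n → Str) (η : Str → Bool), ∃ y : Str, P.Eval x η y

/-- `Q` is total as a program with `n` inputs: it halts on all inputs and all streams. -/
def StmLA.Total (n : ℕ) (Q : StmLA) : Prop :=
  ∀ (x : Fin n → Str) (ω : ℕ → Bool), ∃ y : Str, Q.Eval x ω y

/-- `P` runs in polynomial time: on all inputs and all oracles it halts within a number of steps
polynomial in the total length of the inputs. -/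
def StmRA.PolyTime (n : ℕ) (P : StmRA) : Prop :=
  ∃ p : Polynomial ℕ, ∀ (x : Fin n → Str) (η : Str → Bool),
    ∃ (k : ℕ) (y : Str), P.EvalIn x η k y ∧ k ≤ p.eval (∑ i, (x i).length)

/-- `Q` runs in polynomial time: on all inputs and all streams it halts within a number of steps
polynomial in the total length of the inputs. -/
def StmLA.PolyTime (n : ℕ) (Q : StmLA) : Prop :=
  ∃ p : Polynomial ℕ, ∀ (x : Fin n → Str) (ω : ℕ → Bool),
    ∃ (k : ℕ) (y : Str), Q.EvalIn x ω k y ∧ k ≤ p.eval (∑ i, (x i).length)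

/-- The measure on families of bits indexed by `ι` under which the bits are independent and
uniform; for countable `ι` this is the cylinder measure. -/
noncomputable def coinMeasure (ι : Type) : Measure (ι → Bool) :=
  Measure.infinitePi fun _ : ι => (PMF.uniformOfFintype Bool).toMeasure

end SIFP

/-! The proof is lazy sampling. `Q` follows `P` and keeps, in a register `P` does not use, a table
of the queries made and their answers. A `Flip` looks its query up; if it is absent, a random bit is
drawn and recorded.

A recorded run (`Trace`) yields a table `T` with distinct keys. `Follows ans T` treats both sources
of answers at once: an oracle depends only on the query, a stream only on the position. For fixed
`x` and `y`, let `S` be the set of tables of recorded runs ending with `y` in `R`. Then `P` returns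
`y` on `η` iff `η` follows some `T ∈ S`, and likewise for `Q` and `ω` (`Trace.simulate`). By
determinism (`Trace.det`) no source follows two tables of `S`, and each table is followed with
probability `2⁻¹ ^ |T|` on either side, so both measures are the same sum over `S`
(`coinMeasure_follows`).

Every stream must lead to a finished recorded run (`exists_trace_of_halts`). Answers given lazily
never conflict, so a single oracle agrees with all answers the lazy machine ever gives; `P` halts
with it, hence so does the machine. Conversely each recorded run is a run with some oracle, so a
time bound for `P` bounds its length; register lengths grow by at most a constant per step, so each
table lookup is polynomial. -/

namespace SIFP

/-! ### Determinism of the two semantics -/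

theorem RunRA.det {η : Str → Bool} {s : StmRA} {st st₁ st₂ : Store} {k₁ k₂ : ℕ}
    (h₁ : RunRA η s st k₁ st₁) (h₂ : RunRA η s st k₂ st₂) : k₁ = k₂ ∧ st₁ = st₂ := by
  induction h₁ generalizing k₂ st₂ with
  | assign r e st => cases h₂; exact ⟨rfl, rfl⟩
  | flip e st => cases h₂; exact ⟨rfl, rfl⟩
  | seq _ _ ih₁ ih₂ =>
    cases h₂ with
    | seq a b =>
      obtain ⟨rfl, rfl⟩ := ih₁ a
      obtain ⟨rfl, rfl⟩ := ih₂ b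
      exact ⟨rfl, rfl⟩
  | while_true hg _ _ ih₁ ih₂ =>
    cases h₂ with
    | while_true _ a b =>
      obtain ⟨rfl, rfl⟩ := ih₁ a
      obtain ⟨rfl, rfl⟩ := ih₂ b
      exact ⟨rfl, rfl⟩
    | while_false h => exact absurd hg h
  | while_false hg =>
    cases h₂ with
    | while_true h _ _ => exact absurd h hg
    | while_false _ => exact ⟨rfl, rfl⟩

theorem RunLA.det {s : StmLA} {st st₁ st₂ : Store} {ω ω₁ ω₂ : ℕ → Bool} {k₁ k₂ : ℕ}
    (h₁ : RunLA s st ω k₁ st₁ ω₁) (h₂ : RunLA s st ω k₂ st₂ ω₂) :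
    k₁ = k₂ ∧ st₁ = st₂ ∧ ω₁ = ω₂ := by
  induction h₁ generalizing k₂ st₂ ω₂ with
  | assign r e st => cases h₂; exact ⟨rfl, rfl, rfl⟩
  | randBit st => cases h₂; exact ⟨rfl, rfl, rfl⟩
  | seq _ _ ih₁ ih₂ =>
    cases h₂ with
    | seq a b =>
      obtain ⟨rfl, rfl, rfl⟩ := ih₁ a
      obtain ⟨rfl, rfl, rfl⟩ := ih₂ b
      exact ⟨rfl, rfl, rfl⟩
  | while_true hg _ _ ih₁ ih₂ =>
    cases h₂ with
    | while_true _ a b =>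
      obtain ⟨rfl, rfl, rfl⟩ := ih₁ a
      obtain ⟨rfl, rfl, rfl⟩ := ih₂ b
      exact ⟨rfl, rfl, rfl⟩
    | while_false h => exact absurd hg h
  | while_false hg =>
    cases h₂ with
    | while_true h _ _ => exact absurd h hg
    | while_false _ => exact ⟨rfl, rfl, rfl⟩

theorem StmRA.Eval.det {n : ℕ} {P : StmRA} {x : Fin n → Str} {η : Str → Bool} {y y' : Str}
    (h : P.Eval x η y) (h' : P.Eval x η y') : y = y' := by
  obtain ⟨k, st, h, rfl⟩ := h
  obtain ⟨k', st', h', rfl⟩ := h'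
  rw [(h.det h').2]

theorem StmLA.Eval.det {n : ℕ} {Q : StmLA} {x : Fin n → Str} {ω : ℕ → Bool} {y y' : Str}
    (h : Q.Eval x ω y) (h' : Q.Eval x ω y') : y = y' := by
  obtain ⟨k, st, ω₁, h, rfl⟩ := h
  obtain ⟨k', st', ω₂, h', rfl⟩ := h'
  rw [(h.det h').2.1]

/-! ### Runs that record the oracle answers in a table -/

/-- The oracle queries made so far, in order of first occurrence, with their answers. -/
abbrev Table : Type := List (Str × Bool)

/-- `Trace P st T k st' T'`: the program `P`, started in the store `st` when the oracle answers
recorded in `T` are known, can end in `st'` after `k` steps, with the recorded answers `T'`.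
A query that is not recorded in the table may be answered by either bit. -/
inductive Trace : StmRA → Store → Table → ℕ → Store → Table → Prop
  | assign (r : Id) (e : Exp) (st : Store) (T : Table) :
      Trace (.assign r e) st T 1 (st.set r (e.eval st)) T
  | seq {s t : StmRA} {st st' st'' : Store} {T T' T'' : Table} {k l : ℕ} :
      Trace s st T k st' T' → Trace t st' T' l st'' T'' → Trace (.seq s t) st T (k + l) st'' T''
  | while_true {e : Exp} {s : StmRA} {st st' st'' : Store} {T T' T'' : Table} {k l : ℕ} :
      e.eval st = [true] → Trace s st T k st' T' → Trace (.while e s) st' T' l st'' T'' →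
      Trace (.while e s) st T (1 + k + l) st'' T''
  | while_false {e : Exp} {s : StmRA} {st : Store} {T : Table} :
      e.eval st ≠ [true] → Trace (.while e s) st T 1 st T
  | hit {e : Exp} {st : Store} {T : Table} {b : Bool} :
      (e.eval st, b) ∈ T → (e.eval st, !b) ∉ T → Trace (.flip e) st T 1 (st.set .R [b]) T
  | miss {e : Exp} {st : Store} {T : Table} (b : Bool) :
      (∀ c, (e.eval st, c) ∉ T) →
      Trace (.flip e) st T 1 (st.set .R [b]) (T ++ [(e.eval st, b)])

/-- All answers in the table are given by the function `ans` of position and query. -/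
def Follows (ans : ℕ → Str → Bool) (T : Table) : Prop :=
  ∀ (j : ℕ) (p : Str × Bool), T[j]? = some p → p.2 = ans j p.1

theorem Follows.nil (ans : ℕ → Str → Bool) : Follows ans [] := by
  intro j p h; simp at h

theorem Follows.of_prefix {ans : ℕ → Str → Bool} {T T' : Table} (h : T <+: T')
    (hT : Follows ans T') : Follows ans T := by
  obtain ⟨D, rfl⟩ := h
  intro j p hj
  refine hT j p ?_
  have : j < T.length := by
    by_contra hlt
    rw [List.getElem?_eq_none (by omega)] at hj
    cases hj
  rw [List.getElem?_append_left this, hj]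

theorem Follows.snoc {ans : ℕ → Str → Bool} {T : Table} {p : Str × Bool} :
    Follows ans (T ++ [p]) ↔ Follows ans T ∧ p.2 = ans T.length p.1 := by
  constructor
  · intro h
    exact ⟨h.of_prefix ⟨_, rfl⟩, h T.length p (by simp)⟩
  · rintro ⟨h, hp⟩ j q hq
    rcases lt_trichotomy j T.length with hj | hj | hj
    · rw [List.getElem?_append_left hj] at hq
      exact h j q hq
    · subst hj
      simp at hq
      subst hq
      exact hp
    · rw [List.getElem?_eq_none (by simp; omega)] at hq
      cases hq

theorem follows_oracle_iff {η : Str → Bool} {T : Table} :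
    Follows (fun _ => η) T ↔ ∀ p ∈ T, η p.1 = p.2 := by
  constructor
  · intro h p hp
    obtain ⟨j, hj⟩ := List.mem_iff_getElem?.1 hp
    exact (h j p hj).symm
  · intro h j p hj
    exact (h p (List.mem_of_getElem? hj)).symm

theorem Trace.prefix {s : StmRA} {st st' : Store} {T T' : Table} {k : ℕ}
    (h : Trace s st T k st' T') : T <+: T' := by
  induction h with
  | assign | while_false | hit => exact List.prefix_rfl
  | seq _ _ ih₁ ih₂ | while_true _ _ _ ih₁ ih₂ => exact ih₁.trans ih₂
  | miss => exact ⟨_, rfl⟩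

theorem nodup_keys_snoc {T : Table} {σ : Str} {b : Bool} (hT : (T.map Prod.fst).Nodup)
    (h : ∀ c, (σ, c) ∉ T) : ((T ++ [(σ, b)]).map Prod.fst).Nodup := by
  rw [List.map_append, List.map_singleton, ← List.concat_eq_append, List.nodup_concat]
  refine ⟨?_, hT⟩
  simp only [List.mem_map, not_exists, not_and]
  rintro ⟨σ', c⟩ hc rfl
  exact h c hc

theorem Trace.nodup_keys {s : StmRA} {st st' : Store} {T T' : Table} {k : ℕ}
    (h : Trace s st T k st' T') (hT : (T.map Prod.fst).Nodup) : (T'.map Prod.fst).Nodup := by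
  induction h with
  | assign | while_false | hit => exact hT
  | seq _ _ ih₁ ih₂ | while_true _ _ _ ih₁ ih₂ => exact ih₂ (ih₁ hT)
  | miss b hm => exact nodup_keys_snoc hT hm

theorem Trace.det {ans : ℕ → Str → Bool} {s : StmRA} {st st₁ st₂ : Store} {T T₁ T₂ : Table}
    {k₁ k₂ : ℕ} (h₁ : Trace s st T k₁ st₁ T₁) (h₂ : Trace s st T k₂ st₂ T₂)
    (f₁ : Follows ans T₁) (f₂ : Follows ans T₂) : st₁ = st₂ ∧ T₁ = T₂ := by
  induction h₁ generalizing k₂ st₂ T₂ with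
  | assign r e st => cases h₂; exact ⟨rfl, rfl⟩
  | seq a b ih₁ ih₂ =>
    cases h₂ with
    | seq a' b' =>
      obtain ⟨rfl, rfl⟩ := ih₁ a' (f₁.of_prefix b.prefix) (f₂.of_prefix b'.prefix)
      exact ih₂ b' f₁ f₂
  | while_true hg a b ih₁ ih₂ =>
    cases h₂ with
    | while_true _ a' b' =>
      obtain ⟨rfl, rfl⟩ := ih₁ a' (f₁.of_prefix b.prefix) (f₂.of_prefix b'.prefix)
      exact ih₂ b' f₁ f₂
    | while_false h => exact absurd hg h
  | while_false hg =>
    cases h₂ with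
    | while_true h _ _ => exact absurd h hg
    | while_false _ => exact ⟨rfl, rfl⟩
  | @hit e st T b hb hb' =>
    cases h₂ with
    | @hit _ _ _ b₂ hb₂ _ =>
      have : b₂ = b := by
        by_contra hne
        rw [Bool.eq_not_of_ne hne] at hb₂
        exact hb' hb₂
      subst this
      exact ⟨rfl, rfl⟩
    | miss b₂ h => exact absurd hb (h b)
  | @miss e st T b h =>
    cases h₂ with
    | @hit _ _ _ b₂ hb₂ _ => exact absurd hb₂ (h b₂)
    | miss b₂ h =>
      -- Both new entries stand at position `T.length` with the same query, so `ans` fixes both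
      -- answers.
      have : b = b₂ := (Follows.snoc.1 f₁).2.trans (Follows.snoc.1 f₂).2.symm
      subst this
      exact ⟨rfl, rfl⟩

theorem Trace.runRA {η : Str → Bool} {s : StmRA} {st st' : Store} {T T' : Table} {k : ℕ}
    (h : Trace s st T k st' T') (hη : ∀ p ∈ T', η p.1 = p.2) : RunRA η s st k st' := by
  induction h with
  | assign r e st => exact .assign r e st
  | seq a b ih₁ ih₂ => exact .seq (ih₁ fun p hp => hη p (b.prefix.subset hp)) (ih₂ hη)
  | while_true hg a b ih₁ ih₂ =>
    exact .while_true hg (ih₁ fun p hp => hη p (b.prefix.subset hp)) (ih₂ hη)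
  | while_false hg => exact .while_false hg
  | hit hb hb' =>
    have := hη _ hb
    simp only at this
    rw [← this]
    exact .flip _ _
  | miss b h =>
    have := hη _ (List.mem_append_right _ (List.mem_singleton_self _))
    simp only at this
    rw [← this]
    exact .flip _ _

/-! ### Existence of recorded runs of total programs -/

/-- One step of a machine that executes a list of statements and answers new queries
by `ans`. -/
noncomputable def lazyStep (ans : ℕ → Str → Bool) :
    List StmRA × Store × Table → List StmRA × Store × Table
  | ([], st, T) => ([], st, T)
  | (.assign r e :: l, st, T) => (l, st.set r (e.eval st), T)
  | (.seq s t :: l, st, T) => (s :: t :: l, st, T)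
  | (.while e s :: l, st, T) =>
    if e.eval st = [true] then (s :: .while e s :: l, st, T) else (l, st, T)
  | (.flip e :: l, st, T) =>
    if (e.eval st, true) ∈ T then (l, st.set .R [true], T)
    else if (e.eval st, false) ∈ T then (l, st.set .R [false], T)
    else (l, st.set .R [ans T.length (e.eval st)],
      T ++ [(e.eval st, ans T.length (e.eval st))])

theorem lazyStep_table (ans : ℕ → Str → Bool) (c : List StmRA × Store × Table) :
    c.2.2 <+: (lazyStep ans c).2.2 ∧
      ((c.2.2.map Prod.fst).Nodup → ((lazyStep ans c).2.2.map Prod.fst).Nodup) := by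
  obtain ⟨l, st, T⟩ := c
  rcases l with _ | ⟨s, l⟩
  · exact ⟨List.prefix_rfl, id⟩
  · rcases s with ⟨r, e⟩ | ⟨s, t⟩ | ⟨e, s⟩ | e
    · exact ⟨List.prefix_rfl, id⟩
    · exact ⟨List.prefix_rfl, id⟩
    · simp only [lazyStep]
      split_ifs <;> exact ⟨List.prefix_rfl, id⟩
    · simp only [lazyStep]
      split_ifs with h₁ h₂
      · exact ⟨List.prefix_rfl, id⟩
      · exact ⟨List.prefix_rfl, id⟩
      · exact ⟨⟨_, rfl⟩, fun h => nodup_keys_snoc h (by rintro (_ | _) <;> assumption)⟩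

theorem lazyStep_iterate_nodup (ans : ℕ → Str → Bool) (c : List StmRA × Store × Table)
    (hc : (c.2.2.map Prod.fst).Nodup) (n : ℕ) :
    (((lazyStep ans)^[n] c).2.2.map Prod.fst).Nodup := by
  induction n with
  | zero => exact hc
  | succ n ih =>
    rw [Function.iterate_succ_apply']
    exact (lazyStep_table ans _).2 ih

theorem lazyStep_iterate_prefix (ans : ℕ → Str → Bool) (c : List StmRA × Store × Table)
    {m n : ℕ} (h : m ≤ n) : ((lazyStep ans)^[m] c).2.2 <+: ((lazyStep ans)^[n] c).2.2 := by
  induction n, h using Nat.le_induction with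
  | base => exact List.prefix_rfl
  | succ n _ ih =>
    rw [Function.iterate_succ_apply']
    exact ih.trans (lazyStep_table ans _).1

theorem eq_of_mem_of_nodup_keys {T : Table} (hT : (T.map Prod.fst).Nodup) {σ : Str}
    {b c : Bool} (hb : (σ, b) ∈ T) (hc : (σ, c) ∈ T) : b = c :=
  congrArg Prod.snd (List.inj_on_of_nodup_map hT hb hc rfl)

/-- There is an oracle that agrees with all the answers given by the machine. -/
theorem exists_oracle (ans : ℕ → Str → Bool) (c : List StmRA × Store × Table)
    (hc : (c.2.2.map Prod.fst).Nodup) :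
    ∃ η : Str → Bool, ∀ n, ∀ p ∈ ((lazyStep ans)^[n] c).2.2, η p.1 = p.2 := by
  classical
  -- The tables only grow and keep distinct keys, so an answer 0 recorded at one time excludes an
  -- answer 1 at any other.
  refine ⟨fun σ => decide (∃ n, (σ, true) ∈ ((lazyStep ans)^[n] c).2.2), ?_⟩
  rintro n ⟨σ, b⟩ hp
  cases b with
  | true => simpa using ⟨n, hp⟩
  | false =>
    simp only [decide_eq_false_iff_not, not_exists]
    intro m hm
    have h₁ := (lazyStep_iterate_prefix ans c (le_max_left m n)).subset hm
    have h₂ := (lazyStep_iterate_prefix ans c (le_max_right m n)).subset hp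
    exact absurd (eq_of_mem_of_nodup_keys (lazyStep_iterate_nodup ans c hc _) h₁ h₂) (by simp)

/-- Induction on the run with `η` drives the machine, which is not known in advance to halt; `l` is
its continuation. Since `hη` covers all later tables, it passes to every later configuration by a
shift of `n`. -/
theorem RunRA.exists_trace {ans : ℕ → Str → Bool} {η : Str → Bool} {s : StmRA}
    {st st' : Store} {k : ℕ} (h : RunRA η s st k st') (l : List StmRA) (T : Table)
    (hη : ∀ n, ∀ p ∈ ((lazyStep ans)^[n] (s :: l, st, T)).2.2, η p.1 = p.2)
    (hT : Follows ans T) :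
    ∃ n T', (lazyStep ans)^[n] (s :: l, st, T) = (l, st', T') ∧ Trace s st T k st' T' ∧
      Follows ans T' := by
  induction h generalizing l T with
  | assign r e st => exact ⟨1, T, rfl, .assign r e st T, hT⟩
  | @seq s t st st' st'' k k' a b ih₁ ih₂ =>
    have e₀ : (lazyStep ans)^[1] (.seq s t :: l, st, T) = (s :: t :: l, st, T) := rfl
    obtain ⟨n₁, T₁, e₁, t₁, f₁⟩ := ih₁ (t :: l) T
      (fun n p hp => hη (n + 1) p (by rwa [Function.iterate_add_apply, e₀])) hT
    have e₁' : (lazyStep ans)^[n₁ + 1] (.seq s t :: l, st, T) = (t :: l, st', T₁) := by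
      rw [Function.iterate_add_apply, e₀, e₁]
    obtain ⟨n₂, T₂, e₂, t₂, f₂⟩ := ih₂ l T₁
      (fun n p hp => hη (n + (n₁ + 1)) p (by rwa [Function.iterate_add_apply, e₁'])) f₁
    exact ⟨n₂ + (n₁ + 1), T₂, by rw [Function.iterate_add_apply, e₁', e₂], .seq t₁ t₂, f₂⟩
  | @while_true e s st st' st'' k k' hg a b ih₁ ih₂ =>
    have e₀ : (lazyStep ans)^[1] (.while e s :: l, st, T) = (s :: .while e s :: l, st, T) := by
      simp [lazyStep, hg]
    obtain ⟨n₁, T₁, e₁, t₁, f₁⟩ := ih₁ (.while e s :: l) T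
      (fun n p hp => hη (n + 1) p (by rwa [Function.iterate_add_apply, e₀])) hT
    have e₁' : (lazyStep ans)^[n₁ + 1] (.while e s :: l, st, T) = (.while e s :: l, st', T₁) := by
      rw [Function.iterate_add_apply, e₀, e₁]
    obtain ⟨n₂, T₂, e₂, t₂, f₂⟩ := ih₂ l T₁
      (fun n p hp => hη (n + (n₁ + 1)) p (by rwa [Function.iterate_add_apply, e₁'])) f₁
    exact ⟨n₂ + (n₁ + 1), T₂, by rw [Function.iterate_add_apply, e₁', e₂],
      .while_true hg t₁ t₂, f₂⟩
  | while_false hg => exact ⟨1, T, by simp [lazyStep, hg], .while_false hg, hT⟩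
  | flip e st =>
    have h₀ : ∀ p ∈ T, η p.1 = p.2 := hη 0
    by_cases hb : ∃ b, (e.eval st, b) ∈ T
    · obtain ⟨b, hb⟩ := hb
      have hbη : η (e.eval st) = b := h₀ _ hb
      have hb' : (e.eval st, !b) ∉ T := fun h => by simpa [hbη] using h₀ _ h
      rw [hbη]
      refine ⟨1, T, ?_, .hit hb hb', hT⟩
      cases b <;> simp_all [lazyStep]
    · push Not at hb
      have e₀ : (lazyStep ans)^[1] (.flip e :: l, st, T) =
          (l, st.set .R [ans T.length (e.eval st)],
            T ++ [(e.eval st, ans T.length (e.eval st))]) := by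
        simp [lazyStep, hb]
      -- The table after one step already contains the new answer, so `hη 1` forces `η` to agree
      -- with it.
      have hbη : η (e.eval st) = ans T.length (e.eval st) :=
        hη 1 (e.eval st, ans T.length (e.eval st)) (by rw [e₀]; simp)
      rw [hbη]
      exact ⟨1, _, e₀, .miss _ hb, Follows.snoc.2 ⟨hT, rfl⟩⟩

theorem exists_trace_of_halts (ans : ℕ → Str → Bool) (P : StmRA) (st : Store)
    (h : ∀ η, ∃ k st', RunRA η P st k st') :
    ∃ k st' T, Trace P st [] k st' T ∧ Follows ans T := by
  obtain ⟨η, hη⟩ := exists_oracle ans ([P], st, []) (by simp)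
  obtain ⟨k, st', hr⟩ := h η
  obtain ⟨n, T, -, ht, hf⟩ := hr.exists_trace [] [] hη (Follows.nil ans)
  exact ⟨k, st', T, ht, hf⟩


/-! ### The measure of a cylinder -/

theorem uniform_bool_singleton (b : Bool) :
    (PMF.uniformOfFintype Bool).toMeasure {b} = 2⁻¹ := by
  rw [PMF.toMeasure_apply_singleton _ _ (measurableSet_singleton b)]
  simp

theorem coinMeasure_cylinder {ι : Type} (L : List (ι × Bool)) (hL : (L.map Prod.fst).Nodup) :
    coinMeasure ι {f | ∀ p ∈ L, f p.1 = p.2} = 2⁻¹ ^ L.length := by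
  classical
  -- The cylinder is a box; distinct keys make the value prescribed at `i` unambiguous.
  have hset : {f : ι → Bool | ∀ p ∈ L, f p.1 = p.2} =
      Set.pi ((L.map Prod.fst).toFinset : Set ι) fun i => {decide ((i, true) ∈ L)} := by
    ext f
    simp only [Set.mem_ofPred_eq, Set.mem_pi, List.coe_toFinset, Set.mem_singleton_iff,
      List.mem_map]
    have hval : ∀ p ∈ L, decide ((p.1, true) ∈ L) = p.2 := by
      rintro ⟨i, b⟩ hp
      cases b with
      | true => simpa using hp
      | false =>
        simp only [decide_eq_false_iff_not]
        intro h
        simpa using List.inj_on_of_nodup_map hL hp h rfl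
    constructor
    · rintro h i ⟨p, hp, rfl⟩
      rw [h p hp, hval p hp]
    · intro h p hp
      rw [h p.1 ⟨p, hp, rfl⟩, hval p hp]
  rw [hset, coinMeasure, Measure.infinitePi_pi _ fun i _ => measurableSet_singleton _]
  simp only [uniform_bool_singleton, Finset.prod_const]
  rw [List.toFinset_card_of_nodup hL, List.length_map]

theorem measurableSet_cylinder {ι : Type} (L : List (ι × Bool)) :
    MeasurableSet {f : ι → Bool | ∀ p ∈ L, f p.1 = p.2} := by
  have : {f : ι → Bool | ∀ p ∈ L, f p.1 = p.2} =
      ⋂ p ∈ {p | p ∈ L}, {f : ι → Bool | f p.1 = p.2} := by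
    ext; simp
  rw [this]
  refine MeasurableSet.biInter (List.finite_toSet L).countable fun p _ => ?_
  exact (measurable_pi_apply (X := fun _ : ι => Bool) p.1) (measurableSet_singleton p.2)

theorem follows_stream_iff {ω : ℕ → Bool} {T : Table} :
    Follows (fun j _ => ω j) T ↔ ∀ p ∈ T.zipIdx.map (fun q => (q.2, q.1.2)), ω p.1 = p.2 := by
  simp only [List.mem_map, forall_exists_index, and_imp]
  constructor
  · rintro h _ ⟨p, j⟩ hp rfl
    exact (h j p (List.mem_zipIdx_iff_getElem?.1 hp)).symm
  · intro h j p hp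
    exact (h _ (p, j) (List.mem_zipIdx_iff_getElem?.2 hp) rfl).symm

/-- A family of tables with distinct keys, such that neither an oracle nor a stream is followed by
two of them, has the same probability of being followed by an oracle and by a stream. -/
theorem coinMeasure_follows (S : Set Table) (hS : ∀ T ∈ S, (T.map Prod.fst).Nodup)
    (hdisj : ∀ ans, ∀ T₁ ∈ S, ∀ T₂ ∈ S, Follows ans T₁ → Follows ans T₂ → T₁ = T₂) :
    coinMeasure Str {η | ∃ T ∈ S, Follows (fun _ => η) T} =
      coinMeasure ℕ {ω | ∃ T ∈ S, Follows (fun j _ => ω j) T} := by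
  have h₁ : {η : Str → Bool | ∃ T ∈ S, Follows (fun _ => η) T} =
      ⋃ T ∈ S, {η | ∀ p ∈ T, η p.1 = p.2} := by
    ext η; simp [follows_oracle_iff]
  have h₂ : {ω : ℕ → Bool | ∃ T ∈ S, Follows (fun j _ => ω j) T} =
      ⋃ T ∈ S, {ω | ∀ p ∈ T.zipIdx.map (fun q => (q.2, q.1.2)), ω p.1 = p.2} := by
    ext ω; simp only [Set.mem_ofPred_eq, Set.mem_iUnion, follows_stream_iff, exists_prop]
  rw [h₁, h₂, measure_biUnion S.to_countable ?_ fun T _ => measurableSet_cylinder _,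
    measure_biUnion S.to_countable ?_ fun T _ => measurableSet_cylinder _]
  -- The oracle is constrained at the keys of `T`, the stream at the positions `0, …, |T| - 1`:
  -- equally many distinct coordinates.
  · refine tsum_congr fun T => ?_
    rw [coinMeasure_cylinder _ (hS T T.2), coinMeasure_cylinder, List.length_map,
      List.length_zipIdx]
    rw [List.map_map]
    have : (T : Table).zipIdx.map (Prod.fst ∘ fun q : (Str × Bool) × ℕ => (q.2, q.1.2)) =
        (T : Table).zipIdx.map Prod.snd := rfl
    rw [this, List.zipIdx_map_snd]
    exact List.nodup_range'
  · intro T₁ m₁ T₂ m₂ hne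
    refine Set.disjoint_left.2 fun ω w₁ w₂ => hne ?_
    exact hdisj _ T₁ m₁ T₂ m₂ (follows_stream_iff.2 w₁) (follows_stream_iff.2 w₂)
  · intro T₁ m₁ T₂ m₂ hne
    refine Set.disjoint_left.2 fun η w₁ w₂ => hne ?_
    exact hdisj _ T₁ m₁ T₂ m₂ (follows_oracle_iff.2 w₁) (follows_oracle_iff.2 w₂)


/-! ### Scanning a register symbol by symbol -/

/-- `Det s st k st'`: the program `s`, started in the store `st`, ends in the store `st'` after
`k` steps without reading random bits. -/
def Det (s : StmLA) (st : Store) (k : ℕ) (st' : Store) : Prop :=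
  ∀ ω, RunLA s st ω k st' ω

theorem Det.assign (r : Id) (e : Exp) (st : Store) :
    Det (.assign r e) st 1 (st.set r (e.eval st)) := fun ω => .assign r e st ω

theorem Det.seq {s t : StmLA} {st st' st'' : Store} {k l : ℕ} (h : Det s st k st')
    (h' : Det t st' l st'') : Det (.seq s t) st (k + l) st'' := fun ω => .seq (h ω) (h' ω)

theorem Det.while_true {e : Exp} {s : StmLA} {st st' st'' : Store} {k l : ℕ}
    (hg : e.eval st = [true]) (h : Det s st k st') (h' : Det (.while e s) st' l st'') :
    Det (.while e s) st (1 + k + l) st'' := fun ω => .while_true hg (h ω) (h' ω)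

theorem Det.while_false {e : Exp} {s : StmLA} {st : Store} (hg : e.eval st ≠ [true]) :
    Det (.while e s) st 1 st := fun _ => .while_false hg

/-- The expression `e` followed by the bits of a string. -/
def Exp.append (e : Exp) (a : Str) : Exp := a.foldl Exp.snoc e

theorem Exp.eval_append (st : Store) (e : Exp) (a : Str) :
    (e.append a).eval st = e.eval st ++ a := by
  induction a generalizing e with
  | nil => simp [Exp.append]
  | cons b a ih =>
    have : e.append (b :: a) = (e.snoc b).append a := rfl
    rw [this, ih]
    simp [Exp.eval]

/-- For each of the given symbols, execute the action of the symbol as long as it is the next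
symbol of the register `d` after the cursor `c`. -/
def sweep (d c : Id) (act : Str → StmLA) : List Str → StmLA
  | [] => .assign c (.reg c)
  | a :: l => .seq (.while (.prefixOf ((Exp.reg c).append a) d) (act a)) (sweep d c act l)

/-- Execute the actions of all the symbols of the register `d` in turn. -/
def scan (d c : Id) (act : Str → StmLA) (syms : List Str) : StmLA :=
  .while (.not (.prefixOf (.reg d) c)) (sweep d c act syms)

section scan

variable {d c : Id} {act : Str → StmLA} {syms all : List Str} {L C : ℕ}
  {I : List Str → Store → Prop}

/-- Since all symbols have the same positive length, a prefix test against the whole register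
identifies the next symbol. -/
theorem prefix_next_iff (hL : ∀ a ∈ syms, a.length = L) (h0 : 0 < L) {a : Str}
    (ha : a ∈ syms) {done rest : List Str} (hrest : ∀ b ∈ rest, b ∈ syms) :
    done.flatten ++ a <+: (done ++ rest).flatten ↔ rest.head? = some a := by
  rw [List.flatten_append, List.prefix_append_right_inj]
  cases rest with
  | nil =>
    have := hL a ha
    simp only [List.flatten_nil, List.prefix_nil, List.head?_nil, reduceCtorEq, iff_false]
    rintro rfl
    simp at this
    omega
  | cons b rest =>
    have hab : a.length = b.length := by rw [hL a ha, hL b (hrest b (by simp))]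
    simp only [List.flatten_cons, List.head?_cons, Option.some.injEq]
    constructor
    · rintro ⟨t, ht⟩
      exact (List.append_inj_left ht hab).symm
    · rintro rfl
      exact ⟨_, rfl⟩

/-- Each symbol consumed costs its action and one guard, `C + 1` steps; the failing guard is the
extra 1. -/
theorem run_sweep_while (hL : ∀ a ∈ syms, a.length = L) (h0 : 0 < L)
    (hall : ∀ b ∈ all, b ∈ syms)
    (hI : ∀ done st, I done st → st c = done.flatten ∧ st d = all.flatten)
    (hact : ∀ a ∈ syms, ∀ done st, I done st →
      ∃ k st', Det (act a) st k st' ∧ k ≤ C ∧ I (done ++ [a]) st')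
    {a : Str} (ha : a ∈ syms) (rest done : List Str) (st : Store) (hd : done ++ rest = all)
    (hst : I done st) :
    ∃ done' rest' k st', Det (.while (.prefixOf ((Exp.reg c).append a) d) (act a)) st k st' ∧
      done' ++ rest' = all ∧ I done' st' ∧ k + (C + 1) * rest'.length ≤ (C + 1) * rest.length + 1 ∧
      rest'.length ≤ rest.length ∧ rest'.head? ≠ some a := by
  have hguard : ∀ (done rest : List Str) (st : Store), done ++ rest = all → I done st →
      ((Exp.prefixOf ((Exp.reg c).append a) d).eval st = [true] ↔ rest.head? = some a) := by
    intro done rest st hd hst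
    rw [← prefix_next_iff hL h0 ha (done := done)
      fun b hb => hall b (hd ▸ List.mem_append_right _ hb)]
    simp only [Exp.eval, Exp.eval_append, (hI _ _ hst).1, (hI _ _ hst).2, hd]
    split_ifs with h <;> simp [h]
  induction rest generalizing done st with
  | nil =>
    exact ⟨done, [], 1, st, Det.while_false (by rw [Ne, hguard _ _ _ hd hst]; simp), hd, hst,
      by simp, by simp, by simp⟩
  | cons b rest ih =>
    by_cases hb : b = a
    · subst hb
      obtain ⟨k, st', hr, hk, hst'⟩ := hact b ha done st hst
      obtain ⟨done', rest', k', st'', hr', hd', hst'', hk', hle, hne⟩ :=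
        ih (done ++ [b]) st' (by simpa using hd) hst'
      refine ⟨done', rest', _, st'', Det.while_true ?_ hr hr', hd', hst'', ?_, ?_, hne⟩
      · rw [hguard _ _ _ hd hst]; rfl
      · rw [List.length_cons, Nat.mul_succ]; omega
      · simp; omega
    · refine ⟨done, b :: rest, 1, st, Det.while_false ?_, hd, hst, by omega, le_rfl, ?_⟩
      · rw [Ne, hguard _ _ _ hd hst]; simpa using hb
      · simpa using hb

theorem run_sweep (hL : ∀ a ∈ syms, a.length = L) (h0 : 0 < L)
    (hall : ∀ b ∈ all, b ∈ syms)
    (hI : ∀ done st, I done st → st c = done.flatten ∧ st d = all.flatten)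
    (hact : ∀ a ∈ syms, ∀ done st, I done st →
      ∃ k st', Det (act a) st k st' ∧ k ≤ C ∧ I (done ++ [a]) st')
    (l : List Str) (hl : ∀ a ∈ l, a ∈ syms) (rest done : List Str) (st : Store)
    (hd : done ++ rest = all) (hst : I done st) :
    ∃ done' rest' k st', Det (sweep d c act l) st k st' ∧ done' ++ rest' = all ∧ I done' st' ∧
      k + (C + 1) * rest'.length ≤ (C + 1) * rest.length + l.length + 1 ∧
      rest'.length ≤ rest.length ∧
      (rest'.length = rest.length → ∀ a ∈ l, rest.head? ≠ some a) := by
  induction l generalizing rest done st with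
  | nil =>
    refine ⟨done, rest, 1, st, ?_, hd, hst, by simp; omega, le_rfl, by simp⟩
    -- The closing assignment `c ← c` plays the part of a skip instruction.
    have := Det.assign c (.reg c) st
    rwa [Exp.eval, Store.set, Function.update_eq_self] at this
  | cons a l ih =>
    obtain ⟨done₁, rest₁, k₁, st₁, hr₁, hd₁, hst₁, hk₁, hle₁, hne₁⟩ :=
      run_sweep_while hL h0 hall hI hact (hl a (by simp)) rest done st hd hst
    obtain ⟨done₂, rest₂, k₂, st₂, hr₂, hd₂, hst₂, hk₂, hle₂, hne₂⟩ :=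
      ih (fun b hb => hl b (by simp [hb])) rest₁ done₁ st₁ hd₁ hst₁
    refine ⟨done₂, rest₂, _, st₂, hr₁.seq hr₂, hd₂, hst₂, by simp; omega, by omega, ?_⟩
    intro heq b hb
    have : rest₁ = rest := List.append_inj_right' (hd₁.trans hd.symm) (by omega)
    subst this
    rcases List.mem_cons.1 hb with rfl | hb
    · exact hne₁
    · exact hne₂ (by omega) b hb

/-- A sweep through all symbols meets the next one, so it consumes at least one. Its overhead,
`syms.length + 1` steps and the outer guard, is charged to that symbol: `(C + 1) + (syms.length + 1)
+ 1`. -/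
theorem run_scan (hL : ∀ a ∈ syms, a.length = L) (h0 : 0 < L)
    (hall : ∀ b ∈ all, b ∈ syms)
    (hI : ∀ done st, I done st → st c = done.flatten ∧ st d = all.flatten)
    (hact : ∀ a ∈ syms, ∀ done st, I done st →
      ∃ k st', Det (act a) st k st' ∧ k ≤ C ∧ I (done ++ [a]) st')
    (st : Store) (hst : I [] st) :
    ∃ k st', Det (scan d c act syms) st k st' ∧ I all st' ∧
      k ≤ (C + syms.length + 3) * all.length + 1 := by
  suffices H : ∀ n (rest done : List Str) (st : Store), rest.length = n → done ++ rest = all →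
      I done st → ∃ k st', Det (scan d c act syms) st k st' ∧ I all st' ∧
        k ≤ (C + syms.length + 3) * n + 1 from H _ all [] st rfl rfl hst
  intro n
  induction n using Nat.strong_induction_on with
  | _ n ih =>
    intro rest done st hn hd hst
    rcases rest with _ | ⟨b, rest⟩
    · rw [List.append_nil] at hd
      subst hd
      refine ⟨1, st, Det.while_false ?_, hst, by omega⟩
      simp [Exp.eval, (hI _ _ hst).1, (hI _ _ hst).2]
    · have hb : b ∈ syms := hall b (hd ▸ by simp)
      have hg : (Exp.not (.prefixOf (.reg d) c)).eval st = [true] := by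
        -- The cursor is a proper prefix of the register while a symbol, of positive length, is
        -- left.
        have : ¬ all.flatten <+: done.flatten := by
          intro h
          have h1 := h.length_le
          have h2 := hL b hb
          rw [← hd] at h1
          simp at h1
          simp [h1.1] at h2
          omega
        simp [Exp.eval, (hI _ _ hst).1, (hI _ _ hst).2, this]
      obtain ⟨done₁, rest₁, k₁, st₁, hr₁, hd₁, hst₁, hk₁, hle₁, hne₁⟩ :=
        run_sweep hL h0 hall hI hact syms (fun _ h => h) (b :: rest) done st hd hst
      have hlt : rest₁.length < (b :: rest).length := by
        refine lt_of_le_of_ne hle₁ fun h => hne₁ h b hb rfl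
      obtain ⟨k₂, st₂, hr₂, hst₂, hk₂⟩ := ih _ (hn ▸ hlt) rest₁ done₁ st₁ rfl hd₁ hst₁
      refine ⟨_, st₂, Det.while_true hg hr₁ hr₂, hst₂, ?_⟩
      rw [hn] at hk₁ hlt
      obtain ⟨j, rfl⟩ := Nat.exists_eq_add_of_lt hlt
      nlinarith

end scan

/-! ### The encoding of tables -/

/-- The two-bit symbols that encode an entry of a table. -/
def entry (p : Str × Bool) : List Str := p.1.map (fun x => [true, x]) ++ [[false, p.2]]

/-- The first bit tells a key bit from the answer that closes an entry, so keys of any length are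
delimited; the common length 2 is what scanning needs. -/
def tableSyms : List Str := [[true, false], [true, true], [false, false], [false, true]]

theorem entry_subset (p : Str × Bool) : ∀ a ∈ entry p, a ∈ tableSyms := by
  intro a ha
  simp only [entry, List.mem_append, List.mem_map, List.mem_singleton] at ha
  rcases ha with ⟨_ | _, -, rfl⟩ | rfl
  · simp [tableSyms]
  · simp [tableSyms]
  · cases p.2 <;> simp [tableSyms]

/-- The state of the search for the key `σ` in a table: the part of the current key that has been
read, and whether the entries with answer 0 and with answer 1 have all had other keys. -/
def searchStep (σ : Str) (u : Str × Bool × Bool) (a : Str) : Str × Bool × Bool :=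
  match a with
  | [true, x] => (u.1 ++ [x], u.2)
  | [false, false] => ([], decide (u.1 ≠ σ) && u.2.1, u.2.2)
  | [false, true] => ([], u.2.1, decide (u.1 ≠ σ) && u.2.2)
  | _ => u

def search (σ : Str) (l : List Str) : Str × Bool × Bool := l.foldl (searchStep σ) ([], true, true)

theorem foldl_searchStep_key (σ τ : Str) (u : Str × Bool × Bool) :
    (τ.map fun x => [true, x]).foldl (searchStep σ) u = (u.1 ++ τ, u.2) := by
  induction τ generalizing u with
  | nil => simp
  | cons x τ ih => simp [ih, searchStep]

/-- The search is a left fold, hence induction from the right; each closing symbol resets the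
current key, so entries are treated independently. -/
theorem search_table (σ : Str) (T : Table) :
    search σ (T.flatMap entry) = ([], decide ((σ, false) ∉ T), decide ((σ, true) ∉ T)) := by
  induction T using List.reverseRecOn with
  | nil => simp [search]
  | append_singleton T p ih =>
    obtain ⟨τ, b⟩ := p
    rw [search] at ih
    rw [search, List.flatMap_append, List.foldl_append, ih]
    simp only [List.flatMap_singleton, entry, List.foldl_append, foldl_searchStep_key]
    cases b <;> simp [searchStep, eq_comm, and_comm]

/-! ### The program for a query -/

/-- The action of the symbols in the search for the key in `S (m + 1)`. -/
def searchAct (m : ℕ) (a : Str) : StmLA :=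
  match a with
  | [true, x] => .seq (.assign (.S (m + 3)) (.snoc (.reg (.S (m + 3))) x))
      (.assign (.S (m + 2)) ((Exp.reg (.S (m + 2))).append [true, x]))
  | [false, x] => .seq (.assign (.S (m + 4)) (.prefixOf (.reg (.S (m + 1))) (.S (m + 3))))
      (.seq (.assign (.S (if x then m + 6 else m + 5))
        (.and (.not (.and (.prefixOf (.reg (.S (m + 3))) (.S (m + 1))) (.S (m + 4))))
          (.S (if x then m + 6 else m + 5))))
      (.seq (.assign (.S (m + 3)) .eps)
        (.assign (.S (m + 2)) ((Exp.reg (.S (m + 2))).append [false, x]))))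
  | _ => .assign (.S m) (.reg (.S m))

/-- Append the next bit of a register that is read with the cursor `S (m + 2)`, preceded by the
given tag, to the table in `S m`. -/
def copyAct (m : ℕ) (tag : Bool) (a : Str) : StmLA :=
  .seq (.assign (.S m) ((Exp.reg (.S m)).append (tag :: a)))
    (.assign (.S (m + 2)) ((Exp.reg (.S (m + 2))).append a))

/-- Draw a random bit and append it with the key in `S (m + 1)` to the table in `S m`. -/
def draw (m : ℕ) : StmLA :=
  .seq .randBit (.seq (.assign (.S (m + 2)) .eps)
    (.seq (scan (.S (m + 1)) (.S (m + 2)) (copyAct m true) [[false], [true]])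
    (.seq (.assign (.S (m + 2)) .eps)
    (.seq (scan .R (.S (m + 2)) (copyAct m false) [[false], [true]])
    (.assign (.S (m + 7)) .eps)))))

/-- Put the answer to the query `e` into `R`: the recorded answer if there is one, and a new random
bit, which is recorded, otherwise. -/
def query (m : ℕ) (e : Exp) : StmLA :=
  .seq (.assign (.S (m + 1)) e) (.seq (.assign (.S (m + 2)) .eps)
    (.seq (.assign (.S (m + 3)) .eps) (.seq (.assign (.S (m + 5)) (.snoc .eps true))
    (.seq (.assign (.S (m + 6)) (.snoc .eps true))
    (.seq (scan (.S m) (.S (m + 2)) (searchAct m) tableSyms)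
    (.seq (.assign (.S (m + 7)) (.and (.reg (.S (m + 5))) (.S (m + 6))))
    (.seq (.assign .R (.not (.reg (.S (m + 6)))))
    (.while (.reg (.S (m + 7))) (draw m)))))))))

/-- A number above the indices of all registers `S i` below which the register may occur. -/
def Id.idx : Id → ℕ
  | .S i => i + 1
  | _ => 0

/-- The stores agree on the registers that are not used for the simulation. -/
def AgreeBelow (m : ℕ) (st st' : Store) : Prop := ∀ r : Id, r.idx ≤ m → st' r = st r

theorem AgreeBelow.set_fresh {m i : ℕ} {st st' : Store} (h : AgreeBelow m st st') (hi : m ≤ i)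
    (σ : Str) : AgreeBelow m st (st'.set (.S i) σ) := by
  intro r hr
  rw [Store.set, Function.update_of_ne, h r hr]
  rintro rfl
  simp [Id.idx] at hr
  omega

theorem AgreeBelow.set {m : ℕ} {st st' : Store} (h : AgreeBelow m st st') (r : Id) (σ : Str) :
    AgreeBelow m (st.set r σ) (st'.set r σ) := by
  intro s hs
  by_cases hsr : s = r
  · subst hsr; simp [Store.set]
  · simp [Store.set, hsr, h s hs]

/-- Invariant of the search. -/
structure SearchInv (m : ℕ) (st₀ : Store) (all : List Str) (σ : Str) (done : List Str)
    (st : Store) : Prop where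
  agree : AgreeBelow m st₀ st
  table : st (.S m) = all.flatten
  key : st (.S (m + 1)) = σ
  cursor : st (.S (m + 2)) = done.flatten
  current : st (.S (m + 3)) = (search σ done).1
  no_zero : st (.S (m + 5)) = [(search σ done).2.1]
  no_one : st (.S (m + 6)) = [(search σ done).2.2]

theorem search_snoc (σ : Str) (l : List Str) (a : Str) :
    search σ (l ++ [a]) = searchStep σ (search σ l) a := by
  simp [search]

theorem prefix_and_prefix_iff {σ τ : Str} : (σ <+: τ ∧ τ <+: σ) ↔ σ = τ := by
  constructor
  · rintro ⟨h, h'⟩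
    exact h.eq_of_length (le_antisymm h.length_le h'.length_le)
  · rintro rfl
    exact ⟨List.prefix_rfl, List.prefix_rfl⟩

theorem ite_bool (b : Bool) : (if b = true then [true] else [false]) = [b] := by
  cases b <;> rfl

theorem run_searchAct {m : ℕ} {st₀ : Store} {all : List Str} {σ : Str} {a : Str}
    (ha : a ∈ tableSyms) (done : List Str) (st : Store) (h : SearchInv m st₀ all σ done st) :
    ∃ k st', Det (searchAct m a) st k st' ∧ k ≤ 4 ∧
      SearchInv m st₀ all σ (done ++ [a]) st' := by
  obtain ⟨h₁, h₂, h₃, h₄, h₅, h₆, h₇⟩ := h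
  have key : ∀ x, a = [true, x] → ∃ k st', Det (searchAct m a) st k st' ∧ k ≤ 4 ∧
      SearchInv m st₀ all σ (done ++ [a]) st' := by
    rintro x rfl
    refine ⟨_, _, (Det.assign _ _ _).seq (Det.assign _ _ _), by norm_num, ?_⟩
    constructor
    · exact (h₁.set_fresh (by omega) _).set_fresh (by omega) _
    all_goals
      simp [Store.set, Exp.eval, Exp.eval_append, search_snoc, searchStep, *]
  simp only [tableSyms, List.mem_cons, List.not_mem_nil, or_false] at ha
  rcases ha with rfl | rfl | rfl | rfl
  · exact key _ rfl
  · exact key _ rfl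
  all_goals
    refine ⟨_, _, (Det.assign _ _ _).seq ((Det.assign _ _ _).seq ((Det.assign _ _ _).seq
      (Det.assign _ _ _))), by norm_num, ?_⟩
    constructor
    · refine (((h₁.set_fresh ?_ _).set_fresh ?_ _).set_fresh ?_ _).set_fresh ?_ _ <;> simp
    all_goals simp [Store.set, Exp.eval, Exp.eval_append, search_snoc, searchStep, h₂, h₃, h₄,
      h₅, h₆, h₇]
    -- Equality of keys is tested by two prefix tests, one of them stored in `S (m + 4)` because a
    -- conjunction needs a register.
    have := @prefix_and_prefix_iff (search σ done).1 σ
    by_cases p₁ : (search σ done).1 <+: σ <;> by_cases p₂ : σ <+: (search σ done).1 <;>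
      simp_all [ite_bool]


theorem run_copy {m : ℕ} (tag : Bool) {d : Id} (hd : d ≠ .S m) (hd' : d ≠ .S (m + 2))
    (st : Store) (hc : st (.S (m + 2)) = []) :
    ∃ k st', Det (scan d (.S (m + 2)) (copyAct m tag) [[false], [true]]) st k st' ∧
      k ≤ 7 * (st d).length + 1 ∧ (∀ r, r ≠ .S m → r ≠ .S (m + 2) → st' r = st r) ∧
      st' (.S m) = st (.S m) ++ ((st d).map fun x => [tag, x]).flatten := by
  have hflat : ∀ τ : Str, (τ.map fun x => [x]).flatten = τ := by
    intro τ; induction τ <;> simp_all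
  obtain ⟨k, st', hr, ⟨h₁, -, h₂⟩, hk⟩ := run_scan (d := d) (c := .S (m + 2))
    (act := copyAct m tag) (syms := [[false], [true]]) (all := (st d).map fun x => [x])
    (L := 1) (C := 2)
    (I := fun done st' => (∀ r, r ≠ .S m → r ≠ .S (m + 2) → st' r = st r) ∧
      st' (.S (m + 2)) = done.flatten ∧
      st' (.S m) = st (.S m) ++ (done.flatten.map fun x => [tag, x]).flatten)
    (by simp) one_pos
    (by
      intro b hb
      obtain ⟨_ | _, -, rfl⟩ := List.mem_map.1 hb <;> simp)
    (by
      rintro done st' ⟨h₁, h₂, -⟩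
      exact ⟨h₂, by rw [h₁ d hd hd', hflat]⟩)
    (by
      rintro a ha done st' ⟨h₁, h₂, h₃⟩
      have : ∃ x, a = [x] := by
        simp only [List.mem_cons, List.not_mem_nil, or_false] at ha
        rcases ha with rfl | rfl <;> exact ⟨_, rfl⟩
      obtain ⟨x, rfl⟩ := this
      refine ⟨_, _, (Det.assign _ _ _).seq (Det.assign _ _ _), le_rfl, ?_, ?_, ?_⟩
      · intro r hr hr'
        simp [Store.set, hr, hr', h₁ r hr hr']
      · simp [Store.set, Exp.eval, Exp.eval_append, h₂]
      · simp [Store.set, Exp.eval, Exp.eval_append, h₃])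
    st ⟨fun _ _ _ => rfl, by simpa using hc, by simp⟩
  refine ⟨k, st', hr, ?_, h₁, ?_⟩
  · simpa using hk
  · rw [h₂, hflat]

theorem run_draw {m : ℕ} {st₀ st : Store} (hag : AgreeBelow m st₀ st) (ω : ℕ → Bool) :
    ∃ k st', RunLA (draw m) st ω k st' (fun j => ω (j + 1)) ∧
      k ≤ 7 * (st (.S (m + 1))).length + 13 ∧ AgreeBelow m (st₀.set .R [ω 0]) st' ∧
      st' (.S m) = st (.S m) ++ (entry (st (.S (m + 1)), ω 0)).flatten ∧
      st' (.S (m + 7)) = [] := by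
  set st₁ := (st.set .R [ω 0]).set (.S (m + 2)) [] with hst₁
  obtain ⟨k₂, st₂, hr₂, hk₂, hs₂, hw₂⟩ := run_copy (m := m) true (d := .S (m + 1)) (by simp)
    (by simp) st₁ (by simp [hst₁, Store.set])
  set st₃ := st₂.set (.S (m + 2)) [] with hst₃
  obtain ⟨k₄, st₄, hr₄, hk₄, hs₄, hw₄⟩ := run_copy (m := m) false (d := .R) (by simp)
    (by simp) st₃ (by simp [hst₃, Store.set])
  have hR : st₃ .R = [ω 0] := by
    simp [hst₃, Store.set, hs₂ .R, hst₁]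
  have hK : st₁ (.S (m + 1)) = st (.S (m + 1)) := by simp [hst₁, Store.set]
  refine ⟨_, _, .seq (.randBit st ω) (.seq ((Det.assign _ _ _) _) (.seq (hr₂ _)
    (.seq ((Det.assign _ _ _) _) (.seq (hr₄ _) ((Det.assign _ _ _) _))))), ?_, ?_, ?_, ?_⟩
  · rw [hR] at hk₄
    rw [hK] at hk₂
    simp only [List.length_singleton] at hk₄
    omega
  · refine AgreeBelow.set_fresh ?_ (by omega) _
    intro r hr
    have hne : ∀ i, m ≤ i → r ≠ .S i := by
      rintro i hi rfl
      simp [Id.idx] at hr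
      omega
    rw [hs₄ r (hne _ le_rfl) (hne _ (by omega)), hst₃, Store.set,
      Function.update_of_ne (hne _ (by omega)), hs₂ r (hne _ le_rfl) (hne _ (by omega))]
    exact (hag.set .R [ω 0]).set_fresh (by omega) _ r hr
  · have h₁ : st₃ (.S m) = st₂ (.S m) := by simp [hst₃, Store.set]
    have h₂ : st₁ (.S m) = st (.S m) := by simp [hst₁, Store.set]
    have h₃ : ∀ σ : Str, (st₄.set (.S (m + 7)) σ) (.S m) = st₄ (.S m) := by
      intro σ; simp [Store.set]
    rw [h₃, hw₄, hR, h₁, hw₂, hK, h₂]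
    simp [entry]
  · simp [Store.set, Exp.eval]

/-- A number above the indices of the registers `S i` of the expression, which also bounds the
length that its evaluation can add. -/
def Exp.rank : Exp → ℕ
  | .eps => 0
  | .snoc e _ => e.rank + 1
  | .reg r => r.idx
  | .prefixOf e r => e.rank + r.idx + 1
  | .and e r => e.rank + r.idx + 1
  | .not e => e.rank + 1

/-- Only an upper bound matters, so sums replace maxima. -/
def StmRA.rank : StmRA → ℕ
  | .assign r e => r.idx + e.rank
  | .seq s t => s.rank + t.rank
  | .while e s => e.rank + s.rank
  | .flip e => e.rank

theorem AgreeBelow.eval {m : ℕ} {st st' : Store} (h : AgreeBelow m st st') {e : Exp}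
    (he : e.rank ≤ m) : e.eval st' = e.eval st := by
  induction e with
  | eps => rfl
  | snoc e b ih => simp only [Exp.eval, Exp.rank] at *; rw [ih (by omega)]
  | reg r => exact h r he
  | prefixOf e r ih =>
    simp only [Exp.eval, Exp.rank] at *; rw [ih (by omega), h r (by omega)]
  | and e r ih =>
    simp only [Exp.eval, Exp.rank] at *; rw [ih (by omega), h r (by omega)]
  | not e ih => simp only [Exp.eval, Exp.rank] at *; rw [ih (by omega)]

theorem Exp.length_eval_le {m A : ℕ} {st : Store} (h : ∀ r : Id, r.idx ≤ m → (st r).length ≤ A)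
    {e : Exp} (he : e.rank ≤ m) : (e.eval st).length ≤ A + e.rank := by
  induction e with
  | eps => simp [Exp.eval]
  | snoc e b ih =>
    simp only [Exp.eval, Exp.rank, List.length_append, List.length_singleton] at *
    have := ih (by omega)
    omega
  | reg r => exact (h r he).trans (Nat.le_add_right _ _)
  | prefixOf e r ih =>
    simp only [Exp.eval, Exp.rank]; split_ifs <;> simp <;> omega
  | and e r ih =>
    simp only [Exp.eval, Exp.rank]; split_ifs <;> simp <;> omega
  | not e ih =>
    simp only [Exp.eval, Exp.rank]; split_ifs <;> simp <;> omega

/-- The run of `query` up to the test whether the query is new. -/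
theorem run_query {m : ℕ} {st₀ st : Store} {T : Table} {e : Exp} (he : e.rank ≤ m)
    (hag : AgreeBelow m st₀ st) (hT : st (.S m) = (T.flatMap entry).flatten) :
    ∃ k st₁, (∀ {l st' ω ω'}, RunLA (.while (.reg (.S (m + 7))) (draw m)) st₁ ω l st' ω' →
        RunLA (query m e) st ω (k + l) st' ω') ∧
      k ≤ 11 * (T.flatMap entry).length + 8 ∧
      AgreeBelow m (st₀.set .R [decide ((e.eval st₀, true) ∈ T)]) st₁ ∧
      st₁ (.S m) = (T.flatMap entry).flatten ∧ st₁ (.S (m + 1)) = e.eval st₀ ∧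
      st₁ (.S (m + 7)) = [decide (∀ b, (e.eval st₀, b) ∉ T)] := by
  set σ := e.eval st₀ with hσ
  set st₅ := ((((st.set (.S (m + 1)) σ).set (.S (m + 2)) []).set (.S (m + 3)) []).set
    (.S (m + 5)) [true]).set (.S (m + 6)) [true] with hst₅
  have hinv : SearchInv m st₀ (T.flatMap entry) σ [] st₅ := by
    constructor
    · refine ((((hag.set_fresh ?_ _).set_fresh ?_ _).set_fresh ?_ _).set_fresh ?_ _).set_fresh
        ?_ _ <;> omega
    all_goals simp [hst₅, Store.set, hT, search]
  obtain ⟨k, st₆, hr, h, hk⟩ := run_scan (d := .S m) (c := .S (m + 2)) (act := searchAct m)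
    (syms := tableSyms) (all := T.flatMap entry) (L := 2) (C := 4)
    (I := SearchInv m st₀ (T.flatMap entry) σ) (by simp [tableSyms]) two_pos
    (by
      intro b hb
      obtain ⟨p, -, hp⟩ := List.mem_flatMap.1 hb
      exact entry_subset p b hp)
    (fun done st h => ⟨h.cursor, h.table⟩)
    (fun a ha done st h => run_searchAct ha done st h) st₅ hinv
  obtain ⟨h₁, h₂, h₃, -, -, h₆, h₇⟩ := h
  rw [search_table] at h₆ h₇
  refine ⟨1 + (1 + (1 + (1 + (1 + (k + (1 + 1)))))),
    (st₆.set (.S (m + 7)) [decide (∀ b, (σ, b) ∉ T)]).set .R [decide ((σ, true) ∈ T)],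
    ?_, ?_, ?_, ?_, ?_, ?_⟩
  · intro l st' ω ω' hw
    have a₁ : RunLA (.assign (.S (m + 1)) e) st ω 1 (st.set (.S (m + 1)) σ) ω := by
      rw [hσ, ← hag.eval he]; exact .assign _ _ _ _
    have a₇ : RunLA (.assign (.S (m + 7)) (.and (.reg (.S (m + 5))) (.S (m + 6)))) st₆ ω 1
        (st₆.set (.S (m + 7)) [decide (∀ b, (σ, b) ∉ T)]) ω := by
      convert RunLA.assign _ _ _ _ using 2
      simp only [Exp.eval, h₆, h₇]
      by_cases p : (σ, true) ∈ T <;> by_cases q : (σ, false) ∈ T <;> simp [p, q]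
    have a₈ : RunLA (.assign .R (.not (.reg (.S (m + 6)))))
        (st₆.set (.S (m + 7)) [decide (∀ b, (σ, b) ∉ T)]) ω 1
        ((st₆.set (.S (m + 7)) [decide (∀ b, (σ, b) ∉ T)]).set .R [decide ((σ, true) ∈ T)])
        ω := by
      convert RunLA.assign _ _ _ _ using 2
      have : (st₆.set (.S (m + 7)) [decide (∀ b, (σ, b) ∉ T)]) (.S (m + 6)) = st₆ (.S (m + 6)) := by
        simp [Store.set]
      simp only [Exp.eval, this, h₇]
      by_cases p : (σ, true) ∈ T <;> simp [p]
    have : RunLA (query m e) st ω _ st' ω' := .seq a₁ (.seq (.assign _ _ _ _) (.seq (.assign _ _ _ _) (.seq (.assign _ _ _ _)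
      (.seq (.assign _ _ _ _) (.seq (hr ω) (.seq a₇ (.seq a₈ hw)))))))
    convert this using 1
    omega
  · have : tableSyms.length = 4 := rfl
    rw [this] at hk
    omega
  · exact (h₁.set_fresh (by omega) _).set _ _
  all_goals simp [Store.set, h₂, h₃]

/-! ### The simulation -/

/-- Translate a random-access program, with lazy sampling of the oracle. -/
def StmRA.compile (m : ℕ) : StmRA → StmLA
  | .assign r e => .assign r e
  | .seq s t => .seq (s.compile m) (t.compile m)
  | .while e s => .while e (s.compile m)
  | .flip e => query m e

/-- The store `st'` represents the store `st` and the table `T`, and after `i` steps of the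
simulated program the sizes are bounded. -/
structure Simulates (m a B i : ℕ) (st : Store) (T : Table) (st' : Store) : Prop where
  agree : AgreeBelow m st st'
  table : st' (.S m) = (T.flatMap entry).flatten
  length_reg : ∀ r : Id, r.idx ≤ m → (st r).length ≤ a + (m + 1) * i
  length_table : (T.flatMap entry).length ≤ i * B

theorem Simulates.set {m a B i : ℕ} {st st' : Store} {T : Table}
    (h : Simulates m a B i st T st') {r : Id} (hr : r.idx ≤ m) {σ : Str}
    (hσ : σ.length ≤ a + (m + 1) * (i + 1)) :
    Simulates m a B (i + 1) (st.set r σ) T (st'.set r σ) := by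
  refine ⟨h.agree.set r σ, ?_, ?_, h.length_table.trans (by gcongr; omega)⟩
  · rw [Store.set, Function.update_of_ne, h.table]
    rintro rfl
    simp [Id.idx] at hr
  · intro s hs
    by_cases hsr : s = r
    · subst hsr; simpa [Store.set] using hσ
    · rw [Store.set, Function.update_of_ne hsr]
      exact (h.length_reg s hs).trans (by gcongr; omega)

/-- Induction on the recorded run. The unread stream is `ω` shifted by the table length, since one
bit is read per new entry. `B` bounds the symbols of one entry and `N * B` those of the table, so
`G` bounds the cost of one simulated step. The growth rate `m + 1` also leaves room for the bit put
into `R` when `m = 0`. -/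
theorem Trace.simulate {m a N : ℕ} {s : StmRA} {st st' : Store} {T T' : Table} {k : ℕ}
    (h : Trace s st T k st' T') (hs : s.rank ≤ m) {i : ℕ} (hi : i + k ≤ N) (ω : ℕ → Bool)
    (hω : Follows (fun j _ => ω j) T') (u : Store)
    (hu : Simulates m a (a + (m + 1) * N + 1) i st T u) :
    ∃ k' u', RunLA (s.compile m) u (fun j => ω (j + T.length)) k' u'
        (fun j => ω (j + T'.length)) ∧
      k' ≤ k * (11 * (N * (a + (m + 1) * N + 1)) + 7 * (a + (m + 1) * N + 1) + 30) ∧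
      Simulates m a (a + (m + 1) * N + 1) (i + k) st' T' u' := by
  set B := a + (m + 1) * N + 1 with hB
  set G := 11 * (N * B) + 7 * B + 30 with hG
  induction h generalizing i u with
  | @assign r e st T =>
    simp only [StmRA.rank] at hs
    refine ⟨1, u.set r (e.eval st), ?_, by omega, hu.set (by omega) ?_⟩
    · rw [← hu.agree.eval (e := e) (by omega)]
      exact .assign _ _ _ _
    · have := Exp.length_eval_le hu.length_reg (e := e) (by omega)
      rw [Nat.mul_succ]
      omega
  | seq t₁ t₂ ih₁ ih₂ =>
    simp only [StmRA.rank] at hs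
    obtain ⟨k₁, u₁, r₁, hk₁, s₁⟩ := ih₁ (by omega) (by omega) (hω.of_prefix t₂.prefix) u hu
    obtain ⟨k₂, u₂, r₂, hk₂, s₂⟩ := ih₂ (by omega) (by omega) hω u₁ s₁
    exact ⟨_, u₂, .seq r₁ r₂, by rw [Nat.add_mul]; omega, by rwa [← Nat.add_assoc]⟩
  | @while_true e s st st' st'' T T' T'' k l hg t₁ t₂ ih₁ ih₂ =>
    have hs' := hs
    simp only [StmRA.rank] at hs'
    -- The guard counts as a step, so the body starts at `i + 1`.
    obtain ⟨k₁, u₁, r₁, hk₁, s₁⟩ := ih₁ (i := i + 1) (by omega) (by omega)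
      (hω.of_prefix t₂.prefix) u
      ⟨hu.agree, hu.table, fun r hr => (hu.length_reg r hr).trans (by gcongr; omega),
        hu.length_table.trans (by gcongr; omega)⟩
    obtain ⟨k₂, u₂, r₂, hk₂, s₂⟩ := ih₂ hs (by omega) hω u₁ s₁
    refine ⟨_, u₂, .while_true ?_ r₁ r₂, ?_, ?_⟩
    · rw [hu.agree.eval (by omega), hg]
    · rw [Nat.add_mul, Nat.add_mul]; omega
    · rwa [show i + (1 + k + l) = i + 1 + k + l by omega]
  | @while_false e s st T hg =>
    simp only [StmRA.rank] at hs
    refine ⟨1, u, .while_false ?_, by omega,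
      ⟨hu.agree, hu.table, fun r hr => (hu.length_reg r hr).trans (by gcongr; omega),
        hu.length_table.trans (by gcongr; omega)⟩⟩
    rwa [hu.agree.eval (by omega)]
  | @hit e st T b hb hb' =>
    obtain ⟨k, u₁, hr, hk, hag, htab, -, hnew⟩ := run_query (e := e) hs hu.agree hu.table
    have hdec : decide ((e.eval st, true) ∈ T) = b := by
      cases b <;> simp_all
    rw [hdec] at hag
    have hset := (hu.set (r := .R) (σ := [b]) (by simp [Id.idx])
      (by rw [List.length_singleton, Nat.mul_succ]; omega))
    refine ⟨k + 1, u₁, hr (.while_false ?_), ?_, ⟨hag, htab, hset.length_reg, hset.length_table⟩⟩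
    · have : ¬ ∀ b, (e.eval st, b) ∉ T := fun h => h b hb
      rw [Exp.eval, hnew, decide_eq_false this]
      simp
    · have : i * B ≤ N * B := by gcongr; omega
      have := hu.length_table
      omega
  | @miss e st T b hnew =>
    obtain ⟨k, u₁, hr, hk, hag, htab, hkey, hn⟩ := run_query (e := e) hs hu.agree hu.table
    obtain ⟨k₂, u₂, hr₂, hk₂, hag₂, htab₂, hn₂⟩ := run_draw hag (fun j => ω (j + T.length))
    have hb : b = ω T.length := (Follows.snoc.1 hω).2
    have hset := (hu.set (r := .R) (σ := [b]) (by simp [Id.idx])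
      (by rw [List.length_singleton, Nat.mul_succ]; omega))
    have hσ : (e.eval st).length + 1 ≤ B := by
      have h₁ := Exp.length_eval_le hu.length_reg (e := e) hs
      have h₂ : (m + 1) * (i + 1) ≤ (m + 1) * N := by gcongr
      simp only [StmRA.rank] at hs
      rw [Nat.mul_succ] at h₂
      omega
    -- The loop serves as a conditional: `draw` empties `S (m + 7)`, so its body runs exactly once.
    refine ⟨k + (1 + k₂ + 1), u₂, hr (.while_true ?_ hr₂ ?_), ?_, ?_, ?_, hset.length_reg, ?_⟩
    · rw [Exp.eval, hn, decide_eq_true hnew]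
    · have : (fun j => ω (j + 1 + T.length)) =
          fun j => ω (j + (T ++ [(e.eval st, b)]).length) := by
        funext j
        rw [List.length_append, List.length_singleton]
        congr 1
        omega
      rw [this]
      refine .while_false ?_
      rw [Exp.eval, hn₂]
      simp
    · rw [hkey] at hk₂
      have : i * B ≤ N * B := by gcongr; omega
      have := hu.length_table
      omega
    -- The provisional answer in `R` is overwritten by the drawn bit.
    · simp only [Nat.zero_add, ← hb] at hag₂
      rwa [Store.set, Store.set, Function.update_idem] at hag₂
    · rw [htab₂, htab, hkey, hb]
      simp
    · rw [List.flatMap_append, List.length_append, Nat.add_mul]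
      have := hu.length_table
      have : (entry (e.eval st, b)).length = (e.eval st).length + 1 := by simp [entry]
      rw [List.flatMap_singleton]
      omega

/-! ### Runs from the initial store -/

theorem Store.init_eq {n : ℕ} (x : Fin n → Str) (r : Id) :
    Store.init x r = [] ∨ ∃ i, r = .X (i.val + 1) ∧ Store.init x r = x i := by
  suffices H : ∀ (l : List (Fin n)) (st : Store),
      (st r = [] ∨ ∃ i, r = .X (i.val + 1) ∧ st r = x i) →
      (l.foldl (fun st i => st.set (.X (i.val + 1)) (x i)) st r = [] ∨
        ∃ i, r = .X (i.val + 1) ∧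
          l.foldl (fun st i => st.set (.X (i.val + 1)) (x i)) st r = x i) from
    H _ _ (Or.inl rfl)
  intro l
  induction l with
  | nil => exact fun _ h => h
  | cons i l ih =>
    intro st h
    refine ih _ ?_
    by_cases hr : r = .X (i.val + 1)
    · exact Or.inr ⟨i, hr, by rw [hr]; simp [Store.set]⟩
    · simpa [Store.set, hr] using h

/-- The index `P.rank` makes the table register fresh; it is initially empty and encodes the empty
table. Keeping `N` apart from `k` allows a polynomial bound to be inserted. -/
theorem Trace.evalIn_compile {n : ℕ} {P : StmRA} {x : Fin n → Str} {st : Store} {T : Table}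
    {k : ℕ} (h : Trace P (Store.init x) [] k st T) {ω : ℕ → Bool}
    (hω : Follows (fun j _ => ω j) T) {N : ℕ} (hN : k ≤ N) :
    ∃ k', (P.compile P.rank).EvalIn x ω k' (st .R) ∧
      k' ≤ N * (11 * (N * (∑ i, (x i).length + (P.rank + 1) * N + 1)) +
        7 * (∑ i, (x i).length + (P.rank + 1) * N + 1) + 30) := by
  obtain ⟨k', u', hr, hk', hu'⟩ := h.simulate (m := P.rank) (a := ∑ i, (x i).length) (N := N)
    le_rfl (i := 0) (by omega) ω hω (Store.init x) (by
      refine ⟨fun _ _ => rfl, ?_, ?_, by simp⟩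
      · rcases Store.init_eq x (.S P.rank) with h | ⟨i, h, -⟩
        · simpa using h
        · cases h
      · intro r _
        rcases Store.init_eq x r with h | ⟨i, -, h⟩
        · simp [h]
        · rw [h]
          exact (Finset.single_le_sum (f := fun i => (x i).length) (fun _ _ => Nat.zero_le _)
            (Finset.mem_univ i)).trans (Nat.le_add_right _ _))
  refine ⟨k', ⟨u', _, hr, hu'.agree .R (by simp [Id.idx])⟩, hk'.trans (by gcongr)⟩

theorem Trace.exists_runRA {P : StmRA} {st st' : Store} {T : Table} {k : ℕ}
    (h : Trace P st [] k st' T) : ∃ η, RunRA η P st k st' := by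
  obtain ⟨η, hη⟩ := exists_oracle (fun _ _ => false) ([], st, T) (h.nodup_keys (by simp))
  exact ⟨η, h.runRA (hη 0)⟩

end SIFP

open SIFP in
theorem mainTheorem11 (n : ℕ) (P : SIFP.StmRA) (hP : P.Total n) :
    ∃ Q : SIFP.StmLA, Q.Total n ∧
      (∀ (x : Fin n → SIFP.Str) (y : SIFP.Str),
        SIFP.coinMeasure SIFP.Str {η | P.Eval x η y} = SIFP.coinMeasure ℕ {ω | Q.Eval x ω y}) ∧
      (P.PolyTime n → Q.PolyTime n) := by
  have hex : ∀ (x : Fin n → Str) (ans : ℕ → Str → Bool),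
      ∃ k st T, Trace P (Store.init x) [] k st T ∧ Follows ans T := fun x ans =>
    exists_trace_of_halts ans P _ fun η => by
      obtain ⟨y, k, st, h, -⟩ := hP x η
      exact ⟨k, st, h⟩
  refine ⟨P.compile P.rank, ?_, ?_, ?_⟩
  · intro x ω
    obtain ⟨k, st, T, ht, hf⟩ := hex x fun j _ => ω j
    obtain ⟨k', h', -⟩ := ht.evalIn_compile hf le_rfl
    exact ⟨_, k', h'⟩
  · intro x y
    -- The tables of the recorded runs with result `y`.
    convert coinMeasure_follows {T | ∃ k st, Trace P (Store.init x) [] k st T ∧ st .R = y}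
      ?_ ?_ using 2
    · ext η
      constructor
      · intro h
        obtain ⟨k, st, T, ht, hf⟩ := hex x fun _ => η
        have h' : P.Eval x η (st .R) := ⟨k, st, ht.runRA (follows_oracle_iff.1 hf), rfl⟩
        exact ⟨T, ⟨k, st, ht, h'.det h⟩, hf⟩
      · rintro ⟨T, ⟨k, st, ht, hy⟩, hf⟩
        exact ⟨k, st, ht.runRA (follows_oracle_iff.1 hf), hy⟩
    · ext ω
      constructor
      · intro h
        obtain ⟨k, st, T, ht, hf⟩ := hex x fun j _ => ω j
        obtain ⟨k', h', -⟩ := ht.evalIn_compile hf le_rfl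
        exact ⟨T, ⟨k, st, ht, StmLA.Eval.det ⟨k', h'⟩ h⟩, hf⟩
      · rintro ⟨T, ⟨k, st, ht, rfl⟩, hf⟩
        obtain ⟨k', h', -⟩ := ht.evalIn_compile hf le_rfl
        exact ⟨k', h'⟩
    · rintro T ⟨k, st, ht, -⟩
      exact ht.nodup_keys (by simp)
    · rintro ans T₁ ⟨k₁, st₁, h₁, -⟩ T₂ ⟨k₂, st₂, h₂, -⟩ f₁ f₂
      exact (h₁.det h₂ f₁ f₂).2
  · rintro ⟨p, hp⟩
    -- The bound of `Trace.evalIn_compile`, with `p` for `N` and `X` for the total input length.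
    refine ⟨p * (11 * (p * (.X + (Polynomial.C (P.rank + 1)) * p + 1)) +
      7 * (.X + (Polynomial.C (P.rank + 1)) * p + 1) + 30), fun x ω => ?_⟩
    obtain ⟨k, st, T, ht, hf⟩ := hex x fun j _ => ω j
    -- The run driven by `ω` is also a run with some oracle `η`, so `p` bounds its length.
    obtain ⟨η, hη⟩ := ht.exists_runRA
    obtain ⟨k₁, y, ⟨st₁, h₁, -⟩, hk₁⟩ := hp x η
    rw [(h₁.det hη).1] at hk₁
    obtain ⟨k', h', hk'⟩ := ht.evalIn_compile hf hk₁
    refine ⟨k', _, h', hk'.trans (le_of_eq ?_)⟩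
    simp
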